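/- An arithmetical function is a function $f:\mathbb N=\{1,2,\dots\}\to\mathbb C$. Let $\nu_p(n)$ be the exponent of the prime $p$ in $n$ and put $\xi(n)=\prod_p \nu_p(n)!$. The binomial convolution of $f$ and $g$ is $$(f\circ g)(n)=\sum_{d\mid n}\Bigl(\prod_p\binom{\nu_p(n)}{\nu_p(d)}\Bigr)f(d)\,g(n/d).$$ The exponential Dirichlet series of $f$ is the formal Dirichlet series $$\widetilde D(f,s)=\sum_{n=1}^\infty \frac{f(n)}{\xi(n)\,n^s}.$$ Formal Dirichlet series $\sum_{n\ge1} a(n)n^{-s}$ with complex coefficients form a ring under coefficientwise addition and Dirichlet convolution of coefficients. Infinite sums of formal Dirichlet series are taken in the sense of formal convergence: for each $n$, the coefficient of $n^{-s}$ in the finite partial sums is eventually constant. For a formal Dirichlet series $F$ put $\exp(F)=\sum_{k\ge 0}F^k/k!$, whenever this sum converges formally. The function $f$ is completely multiplicative if $f(1)=1$ and $f(mn)=f(m)f(n)$ for all $m,n\ge1$. Theorem. (1) For all arithmetical functions $f,g$, the series defining $\widetilde D(f,s)$ converges formally and $\widetilde D(f,s)\,\widetilde D(g,s)=\widetilde D(f\circ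 g,s)$. (2) If $f$ is completely multiplicative, then the series $P_f(s)=\sum_p f(p)p^{-s}$ (over all primes $p$) and $\exp(P_f(s))=\sum_{k\ge0}P_f(s)^k/k!$ converge formally, and, as formal Dirichlet series, $$\widetilde D(f,s)=\exp\Bigl(\sum_p \frac{f(p)}{p^s}\Bigr).$$ -/

import Mathlib

noncomputable section

open scoped Nat

/-- The ring of formal Dirichlet series `∑ a(n) n^{-s}` over `ℂ`. As usual in Mathlib, a formal
Dirichlet series is given by its coefficients (with the dummy value `a(0) = 0`); addition and
scalar multiplication are coefficientwise, the product is Dirichlet convolution. -/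
abbrev FormalDirichletSeries := ArithmeticFunction ℂ

namespace FormalDirichletSeries

/-- The topology of formal convergence: the topology of pointwise convergence of the coefficients,
each copy of `ℂ` being discrete. A net converges iff every coefficient is eventually constant
and equal to the coefficient of the limit. -/
instance formalTopology : TopologicalSpace FormalDirichletSeries :=
  TopologicalSpace.induced (fun (F : FormalDirichletSeries) (n : ℕ) => F n)
    (@Pi.topologicalSpace ℕ (fun _ => ℂ) (fun _ => ⊥))

/-- The formal Dirichlet monomial `n^{-s}`, for a positive integer `n`. -/
def monomial (n : ℕ+) : FormalDirichletSeries :=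
  ⟨fun m => if m = (n : ℕ) then 1 else 0, if_neg n.ne_zero.symm⟩

/-- The formal exponential `exp(F) = ∑_{k ≥ 0} F^k / k!`, the sum taken in the sense of formal
convergence. -/
def exp (F : FormalDirichletSeries) : FormalDirichletSeries :=
  ∑' k : ℕ, ((k ! : ℂ)⁻¹) • F ^ k

end FormalDirichletSeries

namespace ArithmeticFunction

/-- The function `ξ(n) = ∏_p ν_p(n)!`. -/
def xi (n : ℕ) : ℕ := ∏ p ∈ n.primeFactors, (n.factorization p)!

/-- The arithmetical function `n ↦ f(n) / ξ(n)`. -/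
def divXi (f : ArithmeticFunction ℂ) : ArithmeticFunction ℂ :=
  ⟨fun n => f n / (xi n : ℂ), by simp⟩

/-- Complete multiplicativity: `f(1) = 1` and `f(mn) = f(m) f(n)` for all `m`, `n`. -/
def IsCompletelyMultiplicative (f : ArithmeticFunction ℂ) : Prop :=
  f 1 = 1 ∧ ∀ m n : ℕ, f (m * n) = f m * f n

/-- The binomial convolution
`(f ∘ g)(n) = ∑_{d ∣ n} (∏_p binom(ν_p(n), ν_p(d))) f(d) g(n/d)`. The product may be restricted to
the primes dividing `n`, since all other factors are `binom(0, 0) = 1`. -/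
def binomialConvolution (f g : ArithmeticFunction ℂ) : ArithmeticFunction ℂ :=
  ⟨fun n => ∑ d ∈ n.divisors,
      ((∏ p ∈ n.primeFactors, (n.factorization p).choose (d.factorization p) : ℕ) : ℂ)
        * f d * g (n / d), by simp⟩

/-- The formal Dirichlet series `D(f, s) = ∑_{n ≥ 1} f(n) n^{-s}`. -/
def dirichletSeries (f : ArithmeticFunction ℂ) : FormalDirichletSeries :=
  ∑' n : ℕ+, f n • FormalDirichletSeries.monomial n

/-- The formal exponential Dirichlet series
`D̃(f, s) = D(f / ξ, s) = ∑_{n ≥ 1} f(n) / (ξ(n) n^s)`. -/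
def expDirichletSeries (f : ArithmeticFunction ℂ) : FormalDirichletSeries :=
  dirichletSeries (divXi f)

/-- The formal prime series `∑_p f(p) p^{-s}`. -/
def primeDirichletSeries (f : ArithmeticFunction ℂ) : FormalDirichletSeries :=
  ∑' p : Nat.Primes, f p • FormalDirichletSeries.monomial p

end ArithmeticFunction

end

namespace FormalDirichletSeries

/-! Every formal series here sums to its own coefficient function, so both claims are identities
between coefficients. For the product, `binom(a, b) * b! * (a - b)! = a!`, taken prime by prime,
shows that division by `ξ` turns binomial convolution into Dirichlet convolution
(`divXi_mul_divXi`). For the exponential, the `n`-th coefficient of `P_f^k` runs over ordered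
factorizations of `n` into `k` primes. There are none unless `Ω(n) = k`, and then there are
`k!/ξ(n)`, each of weight `f(n)` (`primePart_pow_apply`). So in `exp(P_f)` only `k = Ω(n)` reaches
`n`, giving `f(n)/ξ(n)`. -/

instance : T2Space FormalDirichletSeries := by
  -- This overrides the usual topology of `ℂ`. Hausdorffness makes formal sums unique, as
  -- `HasSum.tsum_eq` requires.
  let : TopologicalSpace ℂ := ⊥
  have : DiscreteTopology ℂ := ⟨rfl⟩
  exact T2Space.of_injective_continuous (f := fun (F : FormalDirichletSeries) (n : ℕ) => F n)
    (fun _ _ h => ArithmeticFunction.ext fun n => congrFun h n) continuous_induced_dom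

/-- Formal convergence, read off coefficientwise: if for each `n` only finitely many terms
contribute to the coefficient of `n^{-s}`, the coefficients may be summed separately. -/
theorem hasSum_of_coeff {ι : Type*} {F : ι → FormalDirichletSeries} {G : FormalDirichletSeries}
    (h : ∀ n : ℕ, ∃ s : Finset ι, (∀ i ∉ s, F i n = 0) ∧ ∑ i ∈ s, F i n = G n) :
    HasSum F G := by
  have coeff_sum (t : Finset ι) (n : ℕ) : (∑ i ∈ t, F i) n = ∑ i ∈ t, F i n := by
    classical
    induction t using Finset.induction_on with
    | empty => simp
    | insert a t ha ih => rw [Finset.sum_insert ha, Finset.sum_insert ha,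
        ArithmeticFunction.add_apply, ih]
  have key (n : ℕ) : ∀ᶠ t : Finset ι in Filter.atTop, (∑ i ∈ t, F i) n = G n := by
    obtain ⟨s, hs, hsum⟩ := h n
    filter_upwards [Filter.eventually_ge_atTop s] with t ht
    rw [coeff_sum, ← hsum]
    exact (Finset.sum_subset ht fun i _ hi => hs i hi).symm
  let : TopologicalSpace ℂ := ⊥
  unfold HasSum
  rw [SummationFilter.unconditional_filter, nhds_induced, Filter.tendsto_comap_iff,
    tendsto_pi_nhds]
  intro n
  exact tendsto_const_nhds.congr' ((key n).mono fun t ht => ht.symm)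

theorem smul_monomial_apply (c : ℂ) (n : ℕ+) (m : ℕ) :
    (c • monomial n) m = if m = n then c else 0 := by
  rw [ArithmeticFunction.smul_map]
  simp [monomial]

end FormalDirichletSeries

namespace ArithmeticFunction

open FormalDirichletSeries

theorem hasSum_dirichletSeries (f : ArithmeticFunction ℂ) :
    HasSum (fun n : ℕ+ => f n • monomial n) f := by
  refine hasSum_of_coeff fun m => ?_
  obtain rfl | hm := m.eq_zero_or_pos
  · exact ⟨∅, by simp, by simp⟩
  · obtain ⟨q, rfl⟩ : ∃ q : ℕ+, (q : ℕ) = m := ⟨⟨m, hm⟩, rfl⟩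
    refine ⟨{q}, fun i hi => ?_, ?_⟩
    · rw [smul_monomial_apply, if_neg]
      exact fun h => hi (Finset.mem_singleton.mpr (PNat.coe_injective h.symm))
    · rw [Finset.sum_singleton, smul_monomial_apply, if_pos rfl]

theorem dirichletSeries_eq (f : ArithmeticFunction ℂ) : f.dirichletSeries = f :=
  (hasSum_dirichletSeries f).tsum_eq

theorem expDirichletSeries_eq (f : ArithmeticFunction ℂ) : f.expDirichletSeries = f.divXi :=
  dirichletSeries_eq _

theorem divXi_apply (f : ArithmeticFunction ℂ) (n : ℕ) : f.divXi n = f n / (xi n : ℂ) := rfl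

theorem binomialConvolution_apply (f g : ArithmeticFunction ℂ) (n : ℕ) :
    f.binomialConvolution g n = ∑ d ∈ n.divisors,
      ((∏ p ∈ n.primeFactors, (n.factorization p).choose (d.factorization p) : ℕ) : ℂ)
        * f d * g (n / d) := rfl

theorem xi_ne_zero (n : ℕ) : xi n ≠ 0 :=
  Finset.prod_ne_zero_iff.mpr fun _ _ => Nat.factorial_ne_zero _

theorem xi_one : xi 1 = 1 := by simp [xi]

/-- The extra primes contribute `0! = 1`; a common index set lets the products for `d`, `n / d` and
`n` be compared factor by factor. -/
theorem xi_eq_prod_of_dvd {d n : ℕ} (hn : n ≠ 0) (h : d ∣ n) :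
    xi d = ∏ p ∈ n.primeFactors, (d.factorization p).factorial := by
  refine Finset.prod_subset (Nat.primeFactors_mono h hn) fun p _ hp => ?_
  rw [← Nat.support_factorization, Finsupp.notMem_support_iff] at hp
  simp [hp]

theorem prod_choose_mul_xi_mul_xi {d n : ℕ} (hn : n ≠ 0) (h : d ∣ n) :
    (∏ p ∈ n.primeFactors, (n.factorization p).choose (d.factorization p)) * xi d * xi (n / d) =
      xi n := by
  rw [xi_eq_prod_of_dvd hn h, xi_eq_prod_of_dvd hn (Nat.div_dvd_of_dvd h), xi,
    ← Finset.prod_mul_distrib, ← Finset.prod_mul_distrib]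
  refine Finset.prod_congr rfl fun p _ => ?_
  rw [Nat.factorization_div h, Finsupp.tsub_apply]
  exact Nat.choose_mul_factorial_mul_factorial
    ((Nat.factorization_le_iff_dvd (ne_zero_of_dvd_ne_zero hn h) hn).mpr h p)

theorem divXi_mul_divXi (f g : ArithmeticFunction ℂ) :
    f.divXi * g.divXi = (f.binomialConvolution g).divXi := by
  ext n
  obtain rfl | hn := eq_or_ne n 0
  · simp
  rw [mul_apply, Nat.sum_divisorsAntidiagonal (fun a b => f.divXi a * g.divXi b), divXi_apply,
    binomialConvolution_apply, Finset.sum_div]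
  refine Finset.sum_congr rfl fun d hd => ?_
  rw [divXi_apply, divXi_apply, ← prod_choose_mul_xi_mul_xi hn (Nat.dvd_of_mem_divisors hd)]
  have h1 : (xi d : ℂ) ≠ 0 := Nat.cast_ne_zero.mpr (xi_ne_zero d)
  have h2 : (xi (n / d) : ℂ) ≠ 0 := Nat.cast_ne_zero.mpr (xi_ne_zero _)
  -- The binomial product is now a factor of the denominator, so it must be cancelled too; it is
  -- nonzero because it divides `xi n`.
  have h3 : ((∏ p ∈ n.primeFactors, (n.factorization p).choose (d.factorization p) : ℕ) : ℂ) ≠ 0 := by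
    refine Nat.cast_ne_zero.mpr fun h0 => xi_ne_zero n ?_
    rw [← prod_choose_mul_xi_mul_xi hn (Nat.dvd_of_mem_divisors hd), h0, zero_mul, zero_mul]
  rw [Nat.cast_mul, Nat.cast_mul]
  field_simp

/-- The restriction of an arithmetical function to the primes. -/
def primePart (f : ArithmeticFunction ℂ) : ArithmeticFunction ℂ :=
  ⟨fun n => if n.Prime then f n else 0, by simp⟩

theorem primePart_apply (f : ArithmeticFunction ℂ) (n : ℕ) :
    primePart f n = if n.Prime then f n else 0 := rfl

theorem hasSum_primeDirichletSeries (f : ArithmeticFunction ℂ) :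
    HasSum (fun p : Nat.Primes => f p • monomial p) (primePart f) := by
  refine hasSum_of_coeff fun m => ?_
  have coe_coe (p : Nat.Primes) : ((p : ℕ+) : ℕ) = (p : ℕ) := rfl
  by_cases hm : m.Prime
  · obtain ⟨q, rfl⟩ : ∃ q : Nat.Primes, (q : ℕ) = m := ⟨⟨m, hm⟩, rfl⟩
    refine ⟨{q}, fun i hi => ?_, ?_⟩
    · rw [smul_monomial_apply, coe_coe, if_neg]
      exact fun h => hi (Finset.mem_singleton.mpr (Subtype.ext h.symm))
    · rw [Finset.sum_singleton, smul_monomial_apply, coe_coe, if_pos rfl, primePart_apply,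
        if_pos hm]
  · refine ⟨∅, fun i _ => ?_, by simp [primePart_apply, hm]⟩
    rw [smul_monomial_apply, if_neg]
    rintro rfl
    exact hm i.2

theorem primeDirichletSeries_eq (f : ArithmeticFunction ℂ) :
    f.primeDirichletSeries = primePart f :=
  (hasSum_primeDirichletSeries f).tsum_eq

theorem primePart_mul_apply (f g : ArithmeticFunction ℂ) (n : ℕ) :
    (primePart f * g) n = ∑ p ∈ n.primeFactors, f p * g (n / p) := by
  obtain rfl | hn := eq_or_ne n 0
  · simp
  rw [mul_apply, Nat.sum_divisorsAntidiagonal (fun a b => primePart f a * g b)]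
  have hsub : n.primeFactors ⊆ n.divisors := fun p hp =>
    Nat.mem_divisors.mpr ⟨Nat.dvd_of_mem_primeFactors hp, hn⟩
  rw [← Finset.sum_subset hsub]
  · exact Finset.sum_congr rfl fun p hp => by
      rw [primePart_apply, if_pos (Nat.prime_of_mem_primeFactors hp)]
  · intro d hd hd'
    rw [primePart_apply, if_neg, zero_mul]
    exact fun hp => hd' (Nat.mem_primeFactors.mpr ⟨hp, Nat.dvd_of_mem_divisors hd, hn⟩)

/-- Dividing by `p` lowers only the exponent at `p`, by one, and `a! = a * (a - 1)!`. -/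
theorem xi_eq_factorization_mul_xi_div {n p : ℕ} (hp : p ∈ n.primeFactors) :
    xi n = n.factorization p * xi (n / p) := by
  obtain ⟨hpp, hdvd, hn⟩ := Nat.mem_primeFactors.mp hp
  rw [xi_eq_prod_of_dvd hn (Nat.div_dvd_of_dvd hdvd), xi,
    ← Finset.mul_prod_erase _ _ hp, ← Finset.mul_prod_erase _ _ hp, ← mul_assoc,
    Nat.factorization_div hdvd, hpp.factorization]
  congr 1
  · rw [Finsupp.tsub_apply, Finsupp.single_eq_same,
      Nat.mul_factorial_pred (hpp.factorization_pos_of_dvd hn hdvd).ne']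
  · refine Finset.prod_congr rfl fun q hq => ?_
    rw [Finsupp.tsub_apply, Finsupp.single_eq_of_ne (Finset.ne_of_mem_erase hq), tsub_zero]

theorem cardFactors_div_prime {n p : ℕ} (hp : p ∈ n.primeFactors) :
    cardFactors n = cardFactors (n / p) + 1 := by
  obtain ⟨hpp, hdvd, hn⟩ := Nat.mem_primeFactors.mp hp
  obtain ⟨m, rfl⟩ := hdvd
  rw [Nat.mul_div_cancel_left _ hpp.pos, cardFactors_mul hpp.ne_zero (right_ne_zero_of_mul hn),
    cardFactors_apply_prime hpp, add_comm]

/-- Induction on `k`, splitting off one prime: each `p ∣ n` contributes `ν_p(n) * k! * f(n)/ξ(n)`,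
and the exponents sum to `Ω(n) = k + 1`. -/
theorem primePart_pow_apply {f : ArithmeticFunction ℂ} (hf : f.IsCompletelyMultiplicative)
    (k : ℕ) {n : ℕ} (hn : n ≠ 0) :
    (primePart f ^ k) n = if cardFactors n = k then (k.factorial : ℂ) * f.divXi n else 0 := by
  induction k generalizing n with
  | zero =>
    rw [pow_zero, one_apply]
    by_cases h1 : n = 1
    · subst h1
      simp [divXi_apply, xi_one, hf.1]
    · rw [if_neg h1, if_neg]
      rw [cardFactors_eq_zero_iff_eq_zero_or_one]
      tauto
  | succ k ih =>
    rw [pow_succ', primePart_mul_apply]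
    have hdiv {p : ℕ} (hp : p ∈ n.primeFactors) : n / p ≠ 0 :=
      (Nat.div_pos (Nat.le_of_mem_primeFactors hp) (Nat.pos_of_mem_primeFactors hp)).ne'
    split_ifs with h
    · have hterm : ∀ p ∈ n.primeFactors, f p * (primePart f ^ k) (n / p) =
          (n.factorization p : ℂ) * ((k.factorial : ℂ) * f.divXi n) := by
        intro p hp
        -- Complete multiplicativity is essential here, since `p` may still divide `n / p`.
        have hfn : f n = f p * f (n / p) := by
          rw [← hf.2, Nat.mul_div_cancel' (Nat.dvd_of_mem_primeFactors hp)]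
        have h1 : (xi (n / p) : ℂ) ≠ 0 := Nat.cast_ne_zero.mpr (xi_ne_zero _)
        have h2 : (n.factorization p : ℂ) ≠ 0 := Nat.cast_ne_zero.mpr
          (Finsupp.mem_support_iff.mp (n.support_factorization.symm ▸ hp))
        rw [ih (hdiv hp), if_pos (by have := cardFactors_div_prime hp; omega), divXi_apply,
          divXi_apply, hfn, xi_eq_factorization_mul_xi_div hp, Nat.cast_mul]
        field_simp
      have hcard : ∑ p ∈ n.primeFactors, (n.factorization p : ℂ) = k + 1 := by
        rw [cardFactors_eq_sum_factorization, Finsupp.sum, Nat.support_factorization] at h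
        exact_mod_cast h
      rw [Finset.sum_congr rfl hterm, ← Finset.sum_mul, hcard, Nat.factorial_succ]
      push_cast
      ring
    · refine Finset.sum_eq_zero fun p hp => ?_
      rw [ih (hdiv hp), if_neg (by have := cardFactors_div_prime hp; omega), mul_zero]

theorem hasSum_exp_primeDirichletSeries {f : ArithmeticFunction ℂ}
    (hf : f.IsCompletelyMultiplicative) :
    HasSum (fun k : ℕ => ((k.factorial : ℂ)⁻¹) • f.primeDirichletSeries ^ k) f.divXi := by
  rw [primeDirichletSeries_eq]
  refine hasSum_of_coeff fun n => ?_
  obtain rfl | hn := eq_or_ne n 0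
  · exact ⟨∅, by simp, by simp⟩
  refine ⟨{cardFactors n}, fun k hk => ?_, ?_⟩
  · rw [smul_map, primePart_pow_apply hf k hn,
      if_neg fun h => hk (Finset.mem_singleton.mpr h.symm), smul_zero]
  · rw [Finset.sum_singleton, smul_map, primePart_pow_apply hf _ hn, if_pos rfl, smul_eq_mul,
      inv_mul_cancel_left₀ (Nat.cast_ne_zero.mpr (Nat.factorial_ne_zero _))]

end ArithmeticFunction

theorem theorem5p2 :
    -- product formula; all the defining formal series converge
    (∀ f g : ArithmeticFunction ℂ,
      Summable (fun n : ℕ+ => f.divXi n • FormalDirichletSeries.monomial n) ∧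
      f.expDirichletSeries * g.expDirichletSeries =
        (f.binomialConvolution g).expDirichletSeries) ∧
    -- exponential formula for completely multiplicative functions
    (∀ f : ArithmeticFunction ℂ, f.IsCompletelyMultiplicative →
      Summable (fun p : Nat.Primes => f p • FormalDirichletSeries.monomial p) ∧
      Summable (fun k : ℕ => ((k.factorial : ℂ)⁻¹) • f.primeDirichletSeries ^ k) ∧
      f.expDirichletSeries = FormalDirichletSeries.exp f.primeDirichletSeries) := by
  refine ⟨fun f g => ⟨(ArithmeticFunction.hasSum_dirichletSeries f.divXi).summable, ?_⟩,
    fun f hf => ⟨(ArithmeticFunction.hasSum_primeDirichletSeries f).summable,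
      (ArithmeticFunction.hasSum_exp_primeDirichletSeries hf).summable, ?_⟩⟩
  · simp only [ArithmeticFunction.expDirichletSeries_eq]
    exact ArithmeticFunction.divXi_mul_divXi f g
  · rw [ArithmeticFunction.expDirichletSeries_eq]
    exact (ArithmeticFunction.hasSum_exp_primeDirichletSeries hf).tsum_eq.symm
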